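/- Let $N\ge 1$ and let $\bar A\in\{0,1\}^{N\times N}$ satisfy $\bar A_{nn}=1$ for all $n$. Write $\operatorname{spr}(\bar A)$ for the subspace of all $A\in\mathbb{C}^{N\times N}$ such that $A_{nl}=0$ whenever $\bar A_{nl}=0$. Suppose that the digraph on $\{1,\dots,N\}$ with an edge $(n,l)$ whenever $\bar A_{nl}=1$ contains a directed Hamiltonian cycle, i.e. the vertices can be listed, each exactly once, as $v_1,\dots,v_N$ so that $(v_1,v_2),\dots,(v_{N-1},v_N),(v_N,v_1)$ are all edges (for $N=1$ the cycle is the self-loop). Then for almost all $T\in\mathbb{C}^{N\times N}$ there exist matrices $A_1,\dots,A_N\in\operatorname{spr}(\bar A)$ with $$T=A_NA_{N-1}\cdots A_1 .$$ Likewise, almost every $T\in\mathbb{C}^{N\times N}$ is finite-time computable in $N$ steps over $\bar A$: there exist $A_1,\dots,A_N\in\operatorname{spr}(\bar A)$ such that for every $z\in\mathbb{C}^N$ the iteration $z(0)=z$, $z(k)=A_kz(k-1)$ for $k=1,\dots,N$, satisfies $z(N)=Tz$. Here "almost all" means that the closure in $\mathbb{C}^{N\times N}$ of the set of exceptional $T$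 is nowhere dense and has Lebesgue measure zero. -/

import Mathlib

open MeasureTheory

/-- The sparsity class `spr P`: the subspace of all complex matrices that vanish at every entry
at which `P` vanishes. -/
def spr {N : ℕ} (P : Matrix (Fin N) (Fin N) ℂ) :
    Submodule ℂ (Matrix (Fin N) (Fin N) ℂ) where
  carrier := {Q | ∀ n l, P n l = 0 → Q n l = 0}
  zero_mem' := fun _ _ _ => rfl
  add_mem' := by
    intro Q R hQ hR n l h
    simp [hQ n l h, hR n l h]
  smul_mem' := by
    intro c Q hQ n l h
    simp [hQ n l h]

/-- The digraph on the vertex set `Fin N` associated with a matrix `P`: the pair `(n, l)` is an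
edge if and only if the entry of `P` at `(n, l)` is nonzero. -/
def assocDigraph {N : ℕ} (P : Matrix (Fin N) (Fin N) ℂ) : Digraph (Fin N) where
  Adj n l := P n l ≠ 0

/-- The digraph `G` contains a directed Hamiltonian cycle: its vertices can be listed, each exactly
once, as `v 0, v 1, …, v (N - 1)` such that there is an edge from each vertex of the list to the
cyclically next one (`finRotate N` is `i ↦ i + 1` modulo `N`). For `N = 1` the cycle is a
self-loop. -/
def HasHamiltonianCycle {N : ℕ} (G : Digraph (Fin N)) : Prop :=
  ∃ v : Fin N → Fin N, Function.Bijective v ∧ ∀ i, G.Adj (v i) (v (finRotate N i))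

/-- The product `A d * A (d - 1) * ⋯ * A 1`. -/
def descProd {N : ℕ} (A : ℕ → Matrix (Fin N) (Fin N) ℂ) : ℕ → Matrix (Fin N) (Fin N) ℂ
  | 0 => 1
  | k + 1 => A (k + 1) * descProd A k

/-- The linear iteration `z(k) = A k * z(k - 1)` for `k ≥ 1`, initialized at `z(0) = z`. -/
def iterState {N : ℕ} (A : ℕ → Matrix (Fin N) (Fin N) ℂ) (z : Fin N → ℂ) : ℕ → Fin N → ℂ
  | 0 => z
  | k + 1 => (A (k + 1)).mulVec (iterState A z k)

/-- `T` is finite-time computable in `d` steps over the communication adjacency matrix `Abar`: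
there are weight matrices `A 1, …, A d` in `spr Abar` such that for every initial vector `z`
the iteration reaches `T z` at time `d`. (Only the values `A 1, …, A d` matter.) -/
def FiniteTimeComputable {N : ℕ} (Abar : Matrix (Fin N) (Fin N) ℂ) (d : ℕ)
    (T : Matrix (Fin N) (Fin N) ℂ) : Prop :=
  ∃ A : ℕ → Matrix (Fin N) (Fin N) ℂ, (∀ i, 1 ≤ i → i ≤ d → A i ∈ spr Abar) ∧
    ∀ z : Fin N → ℂ, iterState A z d = T.mulVec z

/-- `p T` holds for almost all complex matrices `T`: the exceptional set has a closure which is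
nowhere dense and of Lebesgue measure zero. The Lebesgue measure is the product measure over the
entries, each of which ranges over `ℂ` with its two-dimensional Lebesgue measure. -/
def ForAlmostAllMatrices {N : ℕ} (p : Matrix (Fin N) (Fin N) ℂ → Prop) : Prop :=
  IsNowhereDense (closure {T : Matrix (Fin N) (Fin N) ℂ | ¬ p T}) ∧
    (volume : Measure (Fin N → Fin N → ℂ))
      ((fun a : Fin N → Fin N → ℂ => (Matrix.of a : Matrix (Fin N) (Fin N) ℂ)) ⁻¹'
        closure {T : Matrix (Fin N) (Fin N) ℂ | ¬ p T}) = 0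

/-!
Let `C` be the permutation matrix of the Hamiltonian cycle. For diagonal matrices `D k` all factors
`D k + C` lie in the sparsity class, and `(D 1, …, D N) ↦ (D N + C) ⋯ (D 1 + C)` is a polynomial map
between spaces of the same dimension `N ^ 2`. Its image is shown to contain the complement of a
proper hypersurface. This complement has a closed exceptional set of measure zero, which is
therefore nowhere dense (`MvPolynomial.addHaar_setOf_eval_eq_zero`).

Dominance is a Jacobian computation (`eq_zero_of_shiftProdDeriv_eq_zero`): the derivative at the
scalar diagonals `D k = k • 1` is injective. Every matrix is uniquely `∑ j < N, E j * C ^ j` with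
diagonal `E j`; as long as degrees stay below `N`, replacing `C ^ j` by `t ^ j` turns
multiplication by `D k + C` into an explicit operator on functions with a parameter `t`
(`shiftSymbol_shiftProdDeriv_succ`). Specializing `t` to `-1, -2, …` isolates the components of a
tangent vector in the kernel one after the other.

An injective derivative at one point makes the components of the map algebraically independent, by
the inverse function theorem (`algebraicIndependent_of_hasDerivAt`). For `N ^ 2` polynomials in
`N ^ 2` variables, the polynomial ring is then algebraic over the subalgebra they generate, hence
integral after inverting one nonzero element `g`, and lying over produces a preimage of each point
where `g` does not vanish (`AlgebraicIndependent.exists_forall_eval_ne_zero_exists_eval_eq`).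
-/

/-! ### Products of matrices supported on the diagonal and a cyclic permutation -/

/-- The product `(D (k - 1) + C) * ⋯ * (D 0 + C)`, where `D i` is the diagonal matrix with diagonal
`x i` and `C` is the permutation matrix of `σ` (with entry `1` at each `(n, σ n)`). The
coefficient ring is arbitrary so that the entries can also be formed as polynomials. -/
def shiftProd {ι R : Type*} [Fintype ι] [DecidableEq ι] [CommRing R] (σ : Equiv.Perm ι)
    (x : ℕ → ι → R) : ℕ → Matrix ι ι R
  | 0 => 1
  | k + 1 => (Matrix.diagonal (x k) + σ.permMatrix R) * shiftProd σ x k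

/-- The derivative of `shiftProd σ · k` at `x` in the direction `v`, given by the Leibniz rule. -/
def shiftProdDeriv {ι R : Type*} [Fintype ι] [DecidableEq ι] [CommRing R] (σ : Equiv.Perm ι)
    (x v : ℕ → ι → R) : ℕ → Matrix ι ι R
  | 0 => 0
  | k + 1 => Matrix.diagonal (v k) * shiftProd σ x k +
      (Matrix.diagonal (x k) + σ.permMatrix R) * shiftProdDeriv σ x v k

section ShiftProd

variable {ι R : Type*} [Fintype ι] [DecidableEq ι] [CommRing R] {σ : Equiv.Perm ι}

theorem permMatrix_mul_apply (M : Matrix ι ι R) (i j : ι) :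
    (σ.permMatrix R * M) i j = M (σ i) j := by
  rw [Equiv.Perm.permMatrix, PEquiv.toMatrix_toPEquiv_mul]; rfl

theorem diagonal_add_permMatrix_mul_apply (y : ι → R) (M : Matrix ι ι R) (i j : ι) :
    ((Matrix.diagonal y + σ.permMatrix R) * M) i j = y i * M i j + M (σ i) j := by
  rw [add_mul, Matrix.add_apply, Matrix.diagonal_mul, permMatrix_mul_apply]

theorem shiftProd_succ_apply (x : ℕ → ι → R) (k : ℕ) (i j : ι) :
    shiftProd σ x (k + 1) i j = x k i * shiftProd σ x k i j + shiftProd σ x k (σ i) j :=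
  diagonal_add_permMatrix_mul_apply _ _ _ _

theorem shiftProdDeriv_succ_apply (x v : ℕ → ι → R) (k : ℕ) (i j : ι) :
    shiftProdDeriv σ x v (k + 1) i j = v k i * shiftProd σ x k i j +
      (x k i * shiftProdDeriv σ x v k i j + shiftProdDeriv σ x v k (σ i) j) := by
  rw [shiftProdDeriv, Matrix.add_apply, Matrix.diagonal_mul, diagonal_add_permMatrix_mul_apply]

theorem map_shiftProd {S : Type*} [CommRing S] (φ : R →+* S) (x : ℕ → ι → R) (k : ℕ) (i j : ι) :
    φ (shiftProd σ x k i j) = shiftProd σ (fun m n => φ (x m n)) k i j := by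
  induction k generalizing i j with
  | zero => simp [shiftProd, Matrix.one_apply, apply_ite φ]
  | succ k ih => simp [shiftProd_succ_apply, ih]

theorem shiftProdDeriv_eq_zero {x v : ℕ → ι → R} {m : ℕ} (hv : ∀ k < m, v k = 0) :
    shiftProdDeriv σ x v m = 0 := by
  induction m with
  | zero => rfl
  | succ m ih =>
    rw [shiftProdDeriv, ih fun k hk => hv k (by lia), hv m (by lia)]
    simp

theorem hasDerivAt_shiftProd {σ : Equiv.Perm ι} (x v : ℕ → ι → ℂ) (k : ℕ) (i j : ι) :
    HasDerivAt (fun t : ℂ => shiftProd σ (fun m n => x m n + t * v m n) k i j)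
      (shiftProdDeriv σ x v k i j) 0 := by
  induction k generalizing i j with
  | zero => exact hasDerivAt_const _ _
  | succ k ih =>
    simp only [shiftProd_succ_apply, shiftProdDeriv_succ_apply]
    have h1 : HasDerivAt (fun t : ℂ => x k i + t * v k i) (v k i) 0 := by
      simpa using ((hasDerivAt_id (0 : ℂ)).mul_const (v k i)).const_add (x k i)
    have h2 := (h1.mul (ih i j)).add (ih (σ i) j)
    simp only [zero_mul, add_zero] at h2
    exact h2.congr_deriv (by ring)

end ShiftProd

/-! ### The symbol of a matrix along a cyclic permutation -/

section Symbol

variable {ι R : Type*} [CommRing R] {σ : Equiv.Perm ι} {N : ℕ}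

/-- If `M = ∑ j < N, D j * C ^ j` with diagonal matrices `D j` and the permutation matrix `C` of an
`N`-cycle `σ`, then the symbol of `M` at `t` is the diagonal of `∑ j < N, t ^ j • D j`. -/
def shiftSymbol (σ : Equiv.Perm ι) (N : ℕ) (t : R) (M : Matrix ι ι R) (n : ι) : R :=
  ∑ j ∈ Finset.range N, t ^ j * M n ((σ ^ j) n)

/-- The matrix `M`, written as in `shiftSymbol`, has degree less than `d` in `C`. -/
def ShiftDegreeLT (σ : Equiv.Perm ι) (N d : ℕ) (M : Matrix ι ι R) : Prop :=
  ∀ n j, d ≤ j → j < N → M n ((σ ^ j) n) = 0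

theorem shiftSymbol_zero (t : R) (n : ι) : shiftSymbol σ N t (0 : Matrix ι ι R) n = 0 := by
  simp [shiftSymbol]

theorem shiftSymbol_add (t : R) (M M' : Matrix ι ι R) (n : ι) :
    shiftSymbol σ N t (M + M') n = shiftSymbol σ N t M n + shiftSymbol σ N t M' n := by
  simp [shiftSymbol, mul_add, Finset.sum_add_distrib]

theorem ShiftDegreeLT.mono {d e : ℕ} {M : Matrix ι ι R} (hM : ShiftDegreeLT σ N d M)
    (h : d ≤ e) : ShiftDegreeLT σ N e M :=
  fun n j hj hN => hM n j (h.trans hj) hN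

theorem ShiftDegreeLT.add {d : ℕ} {M M' : Matrix ι ι R} (hM : ShiftDegreeLT σ N d M)
    (hM' : ShiftDegreeLT σ N d M') : ShiftDegreeLT σ N d (M + M') := fun n j hj hN => by
  rw [Matrix.add_apply, hM n j hj hN, hM' n j hj hN, add_zero]

variable [Fintype ι] [DecidableEq ι]

theorem shiftSymbol_diagonal_mul (t : R) (y : ι → R) (M : Matrix ι ι R) (n : ι) :
    shiftSymbol σ N t (Matrix.diagonal y * M) n = y n * shiftSymbol σ N t M n := by
  simp only [shiftSymbol, Matrix.diagonal_mul, Finset.mul_sum]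
  exact Finset.sum_congr rfl fun _ _ => by ring

/-- Multiplication by `C` multiplies the symbol by `t` and shifts it, as long as the degree does
not reach `N`, where the relation `C ^ N = 1` would interfere. -/
theorem shiftSymbol_permMatrix_mul (hσ : σ ^ N = 1) (t : R) {M : Matrix ι ι R} {d : ℕ}
    (hM : ShiftDegreeLT σ N d M) (hd : d < N) (n : ι) :
    shiftSymbol σ N t (σ.permMatrix R * M) n = t * shiftSymbol σ N t M (σ n) := by
  obtain ⟨K, rfl⟩ : ∃ K, N = K + 1 := ⟨N - 1, by lia⟩
  have htop : ∀ n, M n ((σ ^ K) n) = 0 := fun n => hM n K (by lia) (by lia)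
  have hcycle : M (σ n) n = 0 := by
    have := htop (σ n)
    rwa [← Equiv.Perm.mul_apply, ← pow_succ, hσ, Equiv.Perm.one_apply] at this
  rw [shiftSymbol, shiftSymbol, Finset.sum_range_succ', Finset.sum_range_succ]
  simp only [permMatrix_mul_apply, htop, pow_zero, Equiv.Perm.one_apply, hcycle, mul_zero,
    add_zero, Finset.mul_sum]
  refine Finset.sum_congr rfl fun j _ => ?_
  rw [pow_succ σ, Equiv.Perm.mul_apply]
  ring

theorem ShiftDegreeLT.diagonal_mul {d : ℕ} {M : Matrix ι ι R} (hM : ShiftDegreeLT σ N d M)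
    (y : ι → R) : ShiftDegreeLT σ N d (Matrix.diagonal y * M) := fun n j hj hN => by
  rw [Matrix.diagonal_mul, hM n j hj hN, mul_zero]

theorem ShiftDegreeLT.permMatrix_mul {d : ℕ} {M : Matrix ι ι R} (hM : ShiftDegreeLT σ N d M) :
    ShiftDegreeLT σ N (d + 1) (σ.permMatrix R * M) := fun n j hj hN => by
  obtain ⟨j, rfl⟩ : ∃ i, j = i + 1 := ⟨j - 1, by lia⟩
  rw [permMatrix_mul_apply, pow_succ, Equiv.Perm.mul_apply]
  exact hM (σ n) j (by lia) (by lia)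

theorem shiftDegreeLT_shiftProd (hfree : ∀ n j, 0 < j → j < N → (σ ^ j) n ≠ n)
    (x : ℕ → ι → R) (k : ℕ) : ShiftDegreeLT σ N (k + 1) (shiftProd σ x k) := by
  induction k with
  | zero => exact fun n j hj hN => Matrix.one_apply_ne (hfree n j hj hN).symm
  | succ k ih =>
    rw [shiftProd, add_mul]
    exact ((ih.diagonal_mul _).mono (by lia)).add ih.permMatrix_mul

theorem shiftDegreeLT_shiftProdDeriv (hfree : ∀ n j, 0 < j → j < N → (σ ^ j) n ≠ n)
    (x v : ℕ → ι → R) (k : ℕ) : ShiftDegreeLT σ N k (shiftProdDeriv σ x v k) := by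
  induction k with
  | zero => exact fun n j _ _ => rfl
  | succ k ih =>
    rw [shiftProdDeriv, add_mul]
    exact ((shiftDegreeLT_shiftProd hfree x k).diagonal_mul _).add
      (((ih.diagonal_mul _).mono (by lia)).add ih.permMatrix_mul)

/-- At constant diagonals, the product is a polynomial in `C`. -/
theorem shiftSymbol_shiftProd (hσ : σ ^ N = 1)
    (hfree : ∀ n j, 0 < j → j < N → (σ ^ j) n ≠ n) (a : ℕ → R) (t : R) {k : ℕ} (hk : k < N)
    (n : ι) :
    shiftSymbol σ N t (shiftProd σ (fun m _ => a m) k) n = ∏ m ∈ Finset.range k, (a m + t) := by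
  induction k generalizing n with
  | zero =>
    rw [shiftSymbol, Finset.sum_eq_single 0]
    · have : (1 : Matrix ι ι R) n n = 1 := Matrix.one_apply_eq n
      rw [pow_zero, pow_zero, one_mul, Equiv.Perm.one_apply, Finset.range_zero, Finset.prod_empty]
      exact this
    · intro j hj hj0
      rw [shiftProd, Matrix.one_apply_ne
        (hfree n j (Nat.pos_of_ne_zero hj0) (Finset.mem_range.1 hj)).symm, mul_zero]
    · intro h
      exact absurd (Finset.mem_range.2 hk) h
  | succ k ih =>
    rw [shiftProd, add_mul, shiftSymbol_add, shiftSymbol_diagonal_mul,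
      shiftSymbol_permMatrix_mul hσ t (shiftDegreeLT_shiftProd hfree _ k) hk, ih (by lia),
      ih (by lia), Finset.prod_range_succ]
    ring

theorem shiftSymbol_shiftProdDeriv_succ (hσ : σ ^ N = 1)
    (hfree : ∀ n j, 0 < j → j < N → (σ ^ j) n ≠ n) (a : ℕ → R) (v : ℕ → ι → R) (t : R)
    {k : ℕ} (hk : k < N) (n : ι) :
    shiftSymbol σ N t (shiftProdDeriv σ (fun m _ => a m) v (k + 1)) n =
      v k n * ∏ m ∈ Finset.range k, (a m + t) +
      (a k * shiftSymbol σ N t (shiftProdDeriv σ (fun m _ => a m) v k) n +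
        t * shiftSymbol σ N t (shiftProdDeriv σ (fun m _ => a m) v k) (σ n)) := by
  rw [shiftProdDeriv, add_mul, shiftSymbol_add, shiftSymbol_add, shiftSymbol_diagonal_mul,
    shiftSymbol_diagonal_mul, shiftSymbol_shiftProd hσ hfree a t hk,
    shiftSymbol_permMatrix_mul hσ t (shiftDegreeLT_shiftProdDeriv hfree _ v k) hk]

end Symbol

theorem eq_zero_of_mul_sub_mul_comp_perm {ι K : Type*} [Field K] {σ : Equiv.Perm ι} {N : ℕ}
    (hσ : σ ^ N = 1) {a b : K} (hab : a ^ N ≠ b ^ N) {s : ι → K}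
    (hs : ∀ n, a * s n - b * s (σ n) = 0) (n : ι) : s n = 0 := by
  have key : ∀ k, a ^ k * s n = b ^ k * s ((σ ^ k) n) := by
    intro k
    induction k with
    | zero => simp
    | succ k ih =>
      rw [pow_succ', mul_assoc, ih, pow_succ' σ, Equiv.Perm.mul_apply, pow_succ]
      linear_combination b ^ k * hs ((σ ^ k) n)
  have h := key N
  rw [hσ, Equiv.Perm.one_apply, ← sub_eq_zero, ← sub_mul] at h
  exact (mul_eq_zero.1 h).resolve_left (sub_ne_zero.2 hab)

/-- The derivative of the product is injective at the diagonals `D k = (k + 1) • 1`. At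
`t = -(m + 1)` the symbols of all partial products with more than `m` factors vanish. If `v`
vanishes below `m`, the symbol of the derivative therefore arises from `v m` by a nonzero scalar and by
operators
`s ↦ (k + 1) s - (m + 1) s ∘ σ` with `k > m`, which are injective. -/
theorem eq_zero_of_shiftProdDeriv_eq_zero {ι : Type*} [Fintype ι] [DecidableEq ι]
    {σ : Equiv.Perm ι} {N : ℕ} (hσ : σ ^ N = 1)
    (hfree : ∀ n j, 0 < j → j < N → (σ ^ j) n ≠ n) {v : ℕ → ι → ℂ}
    (h : shiftProdDeriv σ (fun m _ => (m : ℂ) + 1) v N = 0) : ∀ m < N, v m = 0 := by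
  intro m
  induction m using Nat.strong_induction_on with
  | _ m ih =>
    intro hm
    have hd : shiftProdDeriv σ (fun m _ => (m : ℂ) + 1) v m = 0 :=
      shiftProdDeriv_eq_zero fun k hk => ih k hk (by lia)
    set s : ℕ → ι → ℂ := fun k =>
      shiftSymbol σ N (-((m : ℂ) + 1)) (shiftProdDeriv σ (fun m _ => (m : ℂ) + 1) v k) with hs
    have hstep : ∀ k, k < N → ∀ n, s (k + 1) n =
        v k n * ∏ i ∈ Finset.range k, ((i : ℂ) + 1 + -((m : ℂ) + 1)) +
          (((k : ℂ) + 1) * s k n + -((m : ℂ) + 1) * s k (σ n)) := fun k hk n =>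
      shiftSymbol_shiftProdDeriv_succ hσ hfree (fun m => (m : ℂ) + 1) v _ hk n
    have hdown : ∀ k, m + 1 ≤ k → k ≤ N → (∀ n, s k n = 0) → ∀ n, s (m + 1) n = 0 := by
      intro k hk
      induction k, hk using Nat.le_induction with
      | base => exact fun _ h0 => h0
      | succ k hk IH =>
        intro hkN h0
        refine IH (by lia) (eq_zero_of_mul_sub_mul_comp_perm (a := (k : ℂ) + 1)
          (b := (m : ℂ) + 1) hσ ?_ fun n => ?_)
        · have : (k + 1) ^ N ≠ (m + 1) ^ N := fun he => by
            have := Nat.pow_left_injective (n := N) (by lia) he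
            lia
          exact_mod_cast this
        · have h1 := hstep k (by lia) n
          rw [h0, Finset.prod_eq_zero (i := m) (Finset.mem_range.2 (by lia)) (by ring)] at h1
          linear_combination -h1
    have hsm := hdown N (by lia) le_rfl fun n => by rw [hs]; simp only [h, shiftSymbol_zero]
    funext n
    have h1 := hstep m hm n
    have hz : ∀ n, s m n = 0 := fun n => by rw [hs]; simp only [hd, shiftSymbol_zero]
    rw [hsm, hz, hz, mul_zero, mul_zero, add_zero, add_zero] at h1
    refine (mul_eq_zero.1 h1.symm).resolve_right (Finset.prod_ne_zero_iff.2 fun i hi he => ?_)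
    have : (i : ℂ) = m := by linear_combination he
    exact (Finset.mem_range.1 hi).ne (by exact_mod_cast this)

/-! ### Dominant polynomial maps -/

/-- A homomorphism onto an algebraically closed field extends along an integral extension: at a
maximal ideal lying over the kernel, the residue field is integral over `K`, hence equal to it. -/
theorem exists_ringHom_extension_of_isIntegral {A B K : Type*} [CommRing A] [CommRing B]
    [Algebra A B] [Algebra.IsIntegral A B] [Field K] [IsAlgClosed K]
    (hinj : Function.Injective (algebraMap A B)) (φ : A →+* K) (hφ : Function.Surjective φ) :
    ∃ ψ : B →+* K, ∀ a, ψ (algebraMap A B a) = φ a := by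
  have hmax : (RingHom.ker φ).IsMaximal := RingHom.ker_isMaximal_of_surjective φ hφ
  obtain ⟨Q, hQ, hQφ⟩ := Ideal.exists_ideal_over_maximal_of_isIntegral (S := B) (RingHom.ker φ)
    (by rw [(RingHom.injective_iff_ker_eq_bot _).1 hinj]; exact bot_le)
  let f : A →+* B ⧸ Q := (Ideal.Quotient.mk Q).comp (algebraMap A B)
  have hker : ∀ a ∈ RingHom.ker φ, f a = 0 := fun a ha =>
    Ideal.Quotient.eq_zero_iff_mem.2 (by rw [← hQφ] at ha; exact ha)
  let i : K →+* B ⧸ Q :=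
    (Ideal.Quotient.lift (RingHom.ker φ) f hker).comp
      (RingHom.quotientKerEquivOfSurjective hφ).symm.toRingHom
  have hi : ∀ a, i (φ a) = f a := fun a => by
    have : (RingHom.quotientKerEquivOfSurjective hφ).symm (φ a) = Ideal.Quotient.mk _ a := by
      rw [RingEquiv.symm_apply_eq]; rfl
    simp only [i, RingHom.comp_apply, RingEquiv.toRingHom_eq_coe, RingHom.coe_coe, this]
    rfl
  have hfi : f.IsIntegral := RingHom.IsIntegral.trans _ _
    (algebraMap_isIntegral_iff.2 inferInstance)
    (RingHom.isIntegral_of_surjective _ Ideal.Quotient.mk_surjective)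
  have hint : i.IsIntegral := RingHom.IsIntegral.tower_top φ i (by
    have : i.comp φ = f := RingHom.ext hi
    rwa [this])
  have hbij := IsAlgClosed.ringHom_bijective_of_isIntegral i hint
  refine ⟨(RingEquiv.ofBijective i hbij).symm.toRingHom.comp (Ideal.Quotient.mk Q), fun a => ?_⟩
  change (RingEquiv.ofBijective i hbij).symm (f a) = φ a
  rw [RingEquiv.symm_apply_eq]
  exact (hi a).symm

/-- A `K`-valued point of a subring `B` of a polynomial ring over `K` is evaluation at some point of
affine space, provided that some `g` in `B` multiplies all variables into `B` and does not vanish at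
the point. The subring is given by an injective homomorphism `j`. -/
theorem MvPolynomial.exists_eval_eq_of_mul_X_mem {ι K B : Type*} [Field K] [CommRing B]
    {j : B →+* MvPolynomial ι K} (hj : Function.Injective j) (ψ : B →+* K) (c : K → B)
    (hjc : ∀ a, j (c a) = C a) (hψc : ∀ a, ψ (c a) = a) (g : B) (hg : ψ g ≠ 0) (X' : ι → B)
    (hX' : ∀ i, j (X' i) = j g * X i) :
    ∃ x : ι → K, ∀ b, eval x (j b) = ψ b := by
  set x : ι → K := fun i => ψ (X' i) / ψ g with hx
  have hxi : ∀ i, ψ (X' i) = ψ g * x i := fun i => (mul_div_cancel₀ _ hg).symm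
  -- Every polynomial `p` lies in `B` after multiplication by a power of `g`, and `ψ` acts on the
  -- result as evaluation at `x`.
  have key : ∀ p : MvPolynomial ι K, ∃ d : ℕ, ∃ b : B,
      j b = j g ^ d * p ∧ ψ b = ψ g ^ d * eval x p := by
    intro p
    induction p using MvPolynomial.induction_on with
    | C a => exact ⟨0, c a, by rw [hjc, pow_zero, one_mul], by rw [hψc, pow_zero, one_mul, eval_C]⟩
    | add p q hp hq =>
      obtain ⟨d, b, hb, hψb⟩ := hp
      obtain ⟨e, b', hb', hψb'⟩ := hq
      refine ⟨d + e, g ^ e * b + g ^ d * b', ?_, ?_⟩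
      · rw [map_add, map_mul, map_mul, map_pow, map_pow, hb, hb']
        ring
      · rw [map_add, map_mul, map_mul, map_pow, map_pow, hψb, hψb', map_add]
        ring
    | mul_X p i hp =>
      obtain ⟨d, b, hb, hψb⟩ := hp
      refine ⟨d + 1, b * X' i, ?_, ?_⟩
      · rw [map_mul, hb, hX']
        ring
      · rw [map_mul, hψb, hxi, map_mul, eval_X]
        ring
  refine ⟨x, fun b => ?_⟩
  obtain ⟨d, b', hb', hψb'⟩ := key (j b)
  rw [← map_pow, ← map_mul] at hb'
  rw [hj hb', map_mul, map_pow] at hψb'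
  exact (mul_left_cancel₀ (pow_ne_zero d hg) hψb').symm

/-- If `g` multiplies all variables into the integral closure of the subalgebra `A`, then every
`K`-valued point of `A` at which `g` does not vanish comes from a point of affine space. -/
theorem MvPolynomial.exists_eval_eq_of_isIntegral {ι K : Type*} [Field K] [IsAlgClosed K]
    (A : Subalgebra K (MvPolynomial ι K)) (g : A)
    (hg : ∀ i, IsIntegral A ((g : MvPolynomial ι K) * X i)) (φ : A →ₐ[K] K) (hφg : φ g ≠ 0) :
    ∃ x : ι → K, ∀ a : A, eval x (a : MvPolynomial ι K) = φ a := by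
  obtain ⟨ψ, hψ⟩ := exists_ringHom_extension_of_isIntegral (A := A)
    (B := integralClosure A (MvPolynomial ι K))
    (fun a b h => Subtype.ext <|
      congrArg (fun c : integralClosure A (MvPolynomial ι K) => (c : MvPolynomial ι K)) h)
    φ.toRingHom (fun c => ⟨algebraMap K A c, φ.commutes c⟩)
  replace hψ : ∀ a, ψ (algebraMap A _ a) = φ a := hψ
  obtain ⟨x, hx⟩ := exists_eval_eq_of_mul_X_mem
    (j := (integralClosure A (MvPolynomial ι K)).val.toRingHom) Subtype.val_injective ψ
    (fun c => algebraMap A _ (algebraMap K A c)) (fun _ => rfl)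
    (fun c => (hψ _).trans (φ.commutes c)) (algebraMap A _ g) (by rwa [hψ])
    (fun i => ⟨_, hg i⟩) (fun _ => rfl)
  exact ⟨x, fun a => (hx (algebraMap A _ a)).trans (hψ a)⟩

/-- A polynomial self-map of affine space over an algebraically closed field whose components are
algebraically independent attains every value off a proper hypersurface: the polynomial ring is
algebraic over the subalgebra generated by the components, hence integral over it after inverting
one element `g`. -/
theorem AlgebraicIndependent.exists_forall_eval_ne_zero_exists_eval_eq {ι K : Type*} [Fintype ι]
    [Field K] [IsAlgClosed K] {F : ι → MvPolynomial ι K} (hF : AlgebraicIndependent K F) :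
    ∃ g : MvPolynomial ι K, g ≠ 0 ∧ ∀ y, MvPolynomial.eval y g ≠ 0 →
      ∃ x, ∀ i, MvPolynomial.eval x (F i) = y i := by
  classical
  have htr : IsTranscendenceBasis K F := by
    refine hF.isTranscendenceBasis_of_lift_trdeg_le_of_finite ?_
    rw [MvPolynomial.trdeg_of_isDomain, Cardinal.lift_lift]
  have halg := htr.isAlgebraic
  obtain ⟨g, hg0, hg⟩ := Algebra.IsAlgebraic.exists_integral_multiples
    (Algebra.adjoin K (Set.range F))
    (Finset.univ.image (MvPolynomial.X : ι → MvPolynomial ι K))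
  refine ⟨hF.aevalEquiv.symm g, by simpa using hg0, fun y hy => ?_⟩
  let φ : Algebra.adjoin K (Set.range F) →ₐ[K] K :=
    (MvPolynomial.aeval y).comp (hF.aevalEquiv.symm : _ →ₐ[K] _)
  have hφF : ∀ i, φ ⟨F i, Algebra.subset_adjoin ⟨i, rfl⟩⟩ = y i := fun i => by
    have : hF.aevalEquiv.symm ⟨F i, Algebra.subset_adjoin ⟨i, rfl⟩⟩ = MvPolynomial.X i := by
      rw [AlgEquiv.symm_apply_eq]
      ext1
      simp
    change MvPolynomial.aeval y (hF.aevalEquiv.symm _) = _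
    rw [this, MvPolynomial.aeval_X]
  have hφg : φ g ≠ 0 := by
    rwa [← MvPolynomial.coe_aeval_eq_eval] at hy
  obtain ⟨x, hx⟩ := MvPolynomial.exists_eval_eq_of_isIntegral _ g
    (fun i => hg _ (Finset.mem_image_of_mem _ (Finset.mem_univ i))) φ hφg
  exact ⟨x, fun i => (hx _).trans (hφF i)⟩

/-- Jacobian criterion: the components of a polynomial self-map of `ℂ ^ ι` whose derivative is
injective at some point are algebraically independent. By the inverse function theorem the map
attains all values near some point, and a polynomial vanishing on an open set is zero. -/
theorem algebraicIndependent_of_hasDerivAt {ι : Type*} [Fintype ι] {F : ι → MvPolynomial ι ℂ}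
    (x₀ : ι → ℂ)
    (h : ∀ v : ι → ℂ, (∀ i, HasDerivAt (fun t : ℂ => MvPolynomial.eval (x₀ + t • v) (F i)) 0 0) →
      v = 0) :
    AlgebraicIndependent ℂ F := by
  let f : (ι → ℂ) → ι → ℂ := fun x i => MvPolynomial.eval x (F i)
  have hf : HasStrictFDerivAt f (fderiv ℂ f x₀) x₀ := by
    have hcd : ContDiffAt ℂ 1 f x₀ := contDiffAt_pi.2 fun i =>
      (AnalyticOnNhd.eval_mvPolynomial (F i) x₀ (Set.mem_univ _)).contDiffAt
    exact hcd.hasStrictFDerivAt (by simp)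
  have hinj : Function.Injective (fderiv ℂ f x₀) := by
    refine (injective_iff_map_eq_zero _).2 fun v hv => h v fun i => ?_
    have hl : HasDerivAt (fun t : ℂ => x₀ + t • v) v 0 := by
      simpa using ((hasDerivAt_id (0 : ℂ)).smul_const v).const_add x₀
    have hc := HasFDerivAt.comp_hasDerivAt_of_eq (0 : ℂ) hf.hasFDerivAt hl (by simp)
    rw [hv] at hc
    exact hasDerivAt_pi.1 hc i
  have hsurj : (fderiv ℂ f x₀).range = ⊤ :=
    LinearMap.range_eq_top.2 (LinearMap.injective_iff_surjective.1 hinj)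
  have hnhds := hf.map_nhds_eq_of_surj hsurj
  refine algebraicIndependent_iff.2 fun p hp => ?_
  have hz : ∀ x, MvPolynomial.eval (f x) p = 0 := fun x => by
    have := congrArg (MvPolynomial.eval x) hp
    rw [map_zero, MvPolynomial.aeval_def, MvPolynomial.algebraMap_eq,
      MvPolynomial.eval_eval₂] at this
    have hC : (MvPolynomial.eval x).comp MvPolynomial.C = RingHom.id ℂ :=
      RingHom.ext fun c => MvPolynomial.eval_C c
    rwa [hC] at this
  have hev : ∀ᶠ y in nhds (f x₀), MvPolynomial.eval y p = 0 := by
    rw [← hnhds]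
    exact Filter.eventually_map.2 (Filter.Eventually.of_forall hz)
  obtain ⟨ε, hε, hball⟩ := Metric.eventually_nhds_iff_ball.1 hev
  rw [ball_pi _ hε] at hball
  exact MvPolynomial.funext_set _
    (fun i => infinite_of_mem_nhds (f x₀ i) (Metric.ball_mem_nhds _ hε))
    fun y hy => by rw [hball y hy, map_zero]

/-! ### Null sets of polynomials -/

theorem MvPolynomial.IsHomogeneous.eval_smul {ι R : Type*} [Fintype ι] [CommSemiring R]
    {p : MvPolynomial ι R} {n : ℕ} (hp : p.IsHomogeneous n) (c : R) (x : ι → R) :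
    eval (c • x) p = c ^ n * eval x p := by
  rw [eval_eq', eval_eq', Finset.mul_sum]
  refine Finset.sum_congr rfl fun d hd => ?_
  have hn : ∑ i, d i = n := by
    rw [← Finsupp.degree_eq_sum, Finsupp.degree_eq_weight_one]
    exact hp (mem_support_iff.1 hd)
  simp only [Pi.smul_apply, smul_eq_mul, mul_pow, Finset.prod_mul_distrib]
  rw [Finset.prod_pow_eq_pow_sum, hn]
  ring

/-- If `v` is not a zero of the leading form of `g`, then `g` does not vanish identically on any
line in the direction `v`: substituting `z = w⁻¹` in `g (y + z v)` and multiplying by `w ^ deg g`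
gives a function which is continuous at `w = 0`, with the leading form at `v` as value. -/
theorem MvPolynomial.exists_eval_add_smul_ne_zero {ι : Type*} [Fintype ι] {g : MvPolynomial ι ℂ}
    {v : ι → ℂ} (hv : eval v (homogeneousComponent g.totalDegree g) ≠ 0) (y : ι → ℂ) :
    ∃ z : ℂ, eval (y + z • v) g ≠ 0 := by
  by_contra! hzero
  set d := g.totalDegree
  let q : ℂ → ℂ := fun w =>
    ∑ i ∈ Finset.range (d + 1), w ^ (d - i) * eval (w • y + v) (homogeneousComponent i g)
  have hq : ∀ w, w ≠ 0 → q w = 0 := fun w hw => by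
    have h1 : q w = w ^ d * eval (y + w⁻¹ • v) g := by
      conv_rhs => rw [← sum_homogeneousComponent g]
      rw [map_sum, Finset.mul_sum]
      refine Finset.sum_congr rfl fun i hi => ?_
      have hle : i ≤ d := by
        have := Finset.mem_range.1 hi
        lia
      have h2 : w • y + v = w • (y + w⁻¹ • v) := by
        rw [smul_add, smul_smul, mul_inv_cancel₀ hw, one_smul]
      rw [h2, (homogeneousComponent_isHomogeneous i g).eval_smul, ← mul_assoc, ← pow_add,
        Nat.sub_add_cancel hle]
    rw [h1, hzero, mul_zero]
  have hcont : Continuous q := by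
    refine continuous_finsetSum _ fun i _ => (continuous_id.pow _).mul ?_
    exact (MvPolynomial.continuous_eval _).comp (by fun_prop)
  have hq0 : q 0 = 0 := by
    have : q = fun _ => 0 := Continuous.ext_on (s := {0}ᶜ) (dense_compl_singleton 0) hcont
      continuous_const hq
    rw [this]
  refine hv ?_
  rw [← hq0]
  simp only [q]
  rw [Finset.sum_eq_single d]
  · simp
  · intro i hi hid
    have : d - i ≠ 0 := by
      have := Finset.mem_range.1 hi
      lia
    rw [zero_pow this, zero_mul]
  · intro h
    exact absurd (Finset.mem_range.2 (Nat.lt_succ_self d)) h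

/-- The zero set of a nonzero polynomial is a null set, by disintegration along a line direction. -/
theorem MvPolynomial.addHaar_setOf_eval_eq_zero {ι E : Type*} [Fintype ι] [NormedAddCommGroup E]
    [NormedSpace ℂ E] [FiniteDimensional ℂ E] [MeasurableSpace E] [BorelSpace E]
    (μ : Measure E) [μ.IsAddHaarMeasure] (e : E ≃ₗ[ℂ] (ι → ℂ)) {g : MvPolynomial ι ℂ}
    (hg : g ≠ 0) : μ {a | eval (e a) g = 0} = 0 := by
  have hlead : homogeneousComponent g.totalDegree g ≠ 0 := by
    obtain ⟨d, hd, hdeg⟩ := Finset.exists_mem_eq_sup g.support (support_nonempty.2 hg)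
      fun d => d.sum fun _ e => e
    refine fun h => mem_support_iff.1 hd ?_
    have := coeff_homogeneousComponent g.totalDegree g d
    rwa [h, coeff_zero, if_pos (show d.degree = g.totalDegree from hdeg.symm), eq_comm] at this
  obtain ⟨v, hv⟩ : ∃ v, eval v (homogeneousComponent g.totalDegree g) ≠ 0 := by
    by_contra! h
    exact hlead (MvPolynomial.funext fun v => by rw [h, map_zero])
  have hclosed : IsClosed {a | eval (e a) g = 0} :=
    isClosed_eq ((MvPolynomial.continuous_eval g).comp
      (LinearMap.continuous_of_finiteDimensional e.toLinearMap)) continuous_const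
  suffices hae : ∀ᵐ a ∂μ, a ∈ {a | eval (e a) g = 0}ᶜ by
    simpa [ae_iff] using hae
  refine ae_mem_of_ae_add_linearMap_mem 
    (LinearMap.toSpanSingleton ℂ E (e.symm v)) volume μ hclosed.isOpen_compl.measurableSet
    fun a => ?_
  have hfin : {z : ℂ | eval (e a + z • v) g = 0}.Finite := by
    let p : Polynomial ℂ :=
      aeval (fun i => Polynomial.C (e a i) + Polynomial.X * Polynomial.C (v i)) g
    have hp : ∀ z, p.eval z = eval (e a + z • v) g := fun z => by
      change Polynomial.evalRingHom z (aeval _ g) = _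
      rw [map_aeval, ← eval₂_id, coe_eval₂Hom]
      congr 1
      · exact RingHom.ext fun c => Polynomial.eval_C
      · funext i
        simp only [Polynomial.coe_evalRingHom, Polynomial.eval_add, Polynomial.eval_C,
          Polynomial.eval_mul, Polynomial.eval_X, Pi.add_apply, Pi.smul_apply, smul_eq_mul]
    obtain ⟨z, hz⟩ := exists_eval_add_smul_ne_zero hv (e a)
    have hp0 : p ≠ 0 := fun h => hz (by rw [← hp, h, Polynomial.eval_zero])
    refine (Polynomial.finite_setOfPred_isRoot hp0).subset fun z hz => ?_
    exact (hp z).trans hz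
  refine ae_iff.2 (measure_mono_null (fun z hz => ?_) (hfin.measure_zero volume))
  simpa using hz

/-! ### Factoring generic matrices along a cycle -/

theorem forAlmostAllMatrices_of_eval_ne_zero {N : ℕ} {p : Matrix (Fin N) (Fin N) ℂ → Prop}
    {g : MvPolynomial (Fin N × Fin N) ℂ} (hg : g ≠ 0)
    (h : ∀ T : Matrix (Fin N) (Fin N) ℂ, MvPolynomial.eval (fun q => T q.1 q.2) g ≠ 0 → p T) :
    ForAlmostAllMatrices p := by
  let Z : Set (Fin N → Fin N → ℂ) := {a | MvPolynomial.eval (fun q => a q.1 q.2) g = 0}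
  have hZ : IsClosed Z :=
    isClosed_eq ((MvPolynomial.continuous_eval g).comp (by fun_prop)) continuous_const
  have hvol : (volume : Measure (Fin N → Fin N → ℂ)).IsAddHaarMeasure :=
    Measure.pi.isAddHaarMeasure fun _ : Fin N => (volume : Measure (Fin N → ℂ))
  have hnull : volume Z = 0 :=
    MvPolynomial.addHaar_setOf_eval_eq_zero volume (LinearEquiv.curry ℂ ℂ (Fin N) (Fin N)).symm hg
  have hsub : closure {T : Matrix (Fin N) (Fin N) ℂ | ¬ p T} ⊆ Z :=
    closure_minimal (fun T hT => not_not.1 (mt (h T) hT)) hZ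
  refine ⟨?_, measure_mono_null hsub hnull⟩
  rw [IsNowhereDense, closure_closure]
  refine Set.subset_empty_iff.1 ((interior_mono hsub).trans ?_)
  exact (Measure.interior_eq_empty_of_null (μ := volume) hnull).subset

/-- The sequence of diagonals with entries `x (k, n)`, continued for `k ≥ N` by the base values
`k + 1`. -/
def extendDiagonals {N : ℕ} {ι R : Type*} [CommRing R] (x : Fin N × ι → R) (k : ℕ) (n : ι) : R :=
  if h : k < N then x (⟨k, h⟩, n) else (k : R) + 1

/-- Products of `N` matrices `D + C`, with `D` diagonal and `C` the permutation matrix of an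
`N`-cycle, fill the complement of a proper hypersurface. -/
theorem exists_forall_eval_ne_zero_exists_shiftProd_eq {N : ℕ} {σ : Equiv.Perm (Fin N)}
    (hσ : σ ^ N = 1) (hfree : ∀ n j, 0 < j → j < N → (σ ^ j) n ≠ n) :
    ∃ g : MvPolynomial (Fin N × Fin N) ℂ, g ≠ 0 ∧ ∀ T : Matrix (Fin N) (Fin N) ℂ,
      MvPolynomial.eval (fun q => T q.1 q.2) g ≠ 0 →
        ∃ x : ℕ → Fin N → ℂ, shiftProd σ x N = T := by
  let F : Fin N × Fin N → MvPolynomial (Fin N × Fin N) ℂ := fun q =>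
    shiftProd σ (extendDiagonals MvPolynomial.X) N q.1 q.2
  have heval : ∀ x q, MvPolynomial.eval x (F q) = shiftProd σ (extendDiagonals x) N q.1 q.2 := by
    intro x q
    rw [map_shiftProd]
    congr 1
    funext k n
    unfold extendDiagonals
    split_ifs <;> simp
  have hF : AlgebraicIndependent ℂ F := by
    refine algebraicIndependent_of_hasDerivAt (fun q => (q.1 : ℂ) + 1) fun v hv => ?_
    let w : ℕ → Fin N → ℂ := fun k n => if h : k < N then v (⟨k, h⟩, n) else 0
    have hw : shiftProdDeriv σ (fun m _ => (m : ℂ) + 1) w N = 0 := by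
      ext i j
      refine (hasDerivAt_shiftProd _ w N i j).unique ((hv (i, j)).congr_of_eventuallyEq
        (Filter.Eventually.of_forall fun t => ?_))
      dsimp only
      rw [heval]
      congr 1
      funext k n
      simp only [extendDiagonals, w]
      split_ifs <;> simp
    have hw0 := eq_zero_of_shiftProdDeriv_eq_zero hσ hfree hw
    funext ⟨k, n⟩
    simpa [w] using congrFun (hw0 k k.2) n
  obtain ⟨g, hg, hsurj⟩ := hF.exists_forall_eval_ne_zero_exists_eval_eq
  refine ⟨g, hg, fun T hT => ?_⟩
  obtain ⟨x, hx⟩ := hsurj _ hT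
  exact ⟨extendDiagonals x, Matrix.ext fun i j => (heval x (i, j)).symm.trans (hx (i, j))⟩

theorem val_finRotate_pow {N : ℕ} (j : ℕ) (i : Fin N) :
    (((finRotate N) ^ j) i : ℕ) = (i + j) % N := by
  induction j with
  | zero => simp [Nat.mod_eq_of_lt i.2]
  | succ j ih =>
    obtain ⟨K, rfl⟩ : ∃ K, N = K + 1 := ⟨N - 1, by have := i.2; lia⟩
    rw [pow_succ', Equiv.Perm.mul_apply, finRotate_apply, Fin.val_add, ih, Fin.val_one',
      ← Nat.add_mod, add_assoc]

theorem descProd_eq_shiftProd {N : ℕ} (σ : Equiv.Perm (Fin N)) (x : ℕ → Fin N → ℂ) (k : ℕ) :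
    descProd (fun i => Matrix.diagonal (x (i - 1)) + σ.permMatrix ℂ) k = shiftProd σ x k := by
  induction k with
  | zero => rfl
  | succ k ih => rw [descProd, shiftProd, ih, Nat.add_sub_cancel]

theorem iterState_eq_descProd_mulVec {N : ℕ} (A : ℕ → Matrix (Fin N) (Fin N) ℂ) (z : Fin N → ℂ)
    (k : ℕ) : iterState A z k = (descProd A k).mulVec z := by
  induction k with
  | zero => exact (Matrix.one_mulVec z).symm
  | succ k ih => rw [iterState, descProd, ih, Matrix.mulVec_mulVec]

theorem mainTheorem3 (N : ℕ) (Abar : Matrix (Fin N) (Fin N) ℂ)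
    (h01 : ∀ n l, Abar n l = 0 ∨ Abar n l = 1)
    (hdiag : ∀ n, Abar n n = 1)
    (hHam : HasHamiltonianCycle (assocDigraph Abar)) :
    ForAlmostAllMatrices (fun T : Matrix (Fin N) (Fin N) ℂ =>
      ∃ A : ℕ → Matrix (Fin N) (Fin N) ℂ,
        (∀ i, 1 ≤ i → i ≤ N → A i ∈ spr Abar) ∧ T = descProd A N) ∧
    ForAlmostAllMatrices (fun T : Matrix (Fin N) (Fin N) ℂ =>
      FiniteTimeComputable Abar N T) := by
  obtain ⟨v, hv, hedge⟩ := hHam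
  let e : Fin N ≃ Fin N := Equiv.ofBijective v hv
  -- The successor map along the Hamiltonian cycle.
  let σ : Equiv.Perm (Fin N) := e * finRotate N * e⁻¹
  have hpow : ∀ j n, (σ ^ j) n = e (((finRotate N) ^ j) (e⁻¹ n)) := fun j n => by
    rw [conj_pow]; rfl
  have hσ : σ ^ N = 1 := by
    have : (finRotate N) ^ N = 1 := Equiv.ext fun i => Fin.ext <| by
      rw [val_finRotate_pow, Nat.add_mod_right, Nat.mod_eq_of_lt i.2, Equiv.Perm.one_apply]
    rw [conj_pow, this, mul_one, mul_inv_cancel]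
  have hfree : ∀ n j, 0 < j → j < N → (σ ^ j) n ≠ n := by
    intro n j hj hjN h
    rw [hpow, ← Equiv.Perm.eq_inv_iff_eq] at h
    have h' := congrArg Fin.val h
    rw [val_finRotate_pow] at h'
    have hlt := (e⁻¹ n).2
    rcases lt_or_ge ((e⁻¹ n : ℕ) + j) N with hc | hc
    · rw [Nat.mod_eq_of_lt hc] at h'
      lia
    · rw [Nat.mod_eq_sub_mod hc, Nat.mod_eq_of_lt (by lia)] at h'
      lia
  have hmem : ∀ y : Fin N → ℂ, Matrix.diagonal y + σ.permMatrix ℂ ∈ spr Abar := by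
    intro y n l hnl
    have hne : n ≠ l := fun h => by
      rw [h, hdiag] at hnl
      exact one_ne_zero hnl
    have hσn : σ n ≠ l := fun h => by
      refine hedge (e⁻¹ n) ?_
      have h1 : v (e⁻¹ n) = n := e.apply_symm_apply n
      rw [h1, ← hnl, ← h]
      rfl
    rw [Matrix.add_apply, Matrix.diagonal_apply_ne _ hne, zero_add]
    simp [Equiv.Perm.permMatrix, PEquiv.toMatrix_apply, hσn]
  obtain ⟨g, hg, hfactor⟩ := exists_forall_eval_ne_zero_exists_shiftProd_eq hσ hfree
  constructor
  · refine forAlmostAllMatrices_of_eval_ne_zero hg fun T hT => ?_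
    obtain ⟨x, rfl⟩ := hfactor T hT
    exact ⟨_, fun i _ _ => hmem (x (i - 1)), (descProd_eq_shiftProd σ x N).symm⟩
  · refine forAlmostAllMatrices_of_eval_ne_zero hg fun T hT => ?_
    obtain ⟨x, rfl⟩ := hfactor T hT
    refine ⟨_, fun i _ _ => hmem (x (i - 1)), fun z => ?_⟩
    rw [iterState_eq_descProd_mulVec, descProd_eq_shiftProd]
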